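/- Let $\Sigma$ be a finite alphabet. A pomset over $\Sigma$ is an isomorphism class of $\Sigma$-labelled partially ordered sets; $1$ is the empty pomset, a letter $a$ also denotes the one-event pomset labelled $a$, $U\cdot V$ is the disjoint union of $U$ and $V$ with every event of $U$ placed below every event of $V$, and $U\parallel V$ is the disjoint union with no order between the two parts. $\mathsf{SP}(\Sigma)$ is the smallest set of pomsets that contains $1$ and the letters and is closed under $\cdot$ and $\parallel$. $\mathbb{M}(Q)$ is the set of finite multisets over $Q$. A pomset automaton is a tuple $A=\langle Q,F,\delta,\gamma\rangle$ with a set of states $Q$, accepting states $F\subseteq Q$, and functions $\delta:Q\times\Sigma\to 2^Q$ and $\gamma:Q\times\mathbb{M}(Q)\to 2^Q$, such that for each $q\in Q$ only finitely many $\phi$ satisfy $\gamma(q,\phi)\neq\emptyset$. It is finite if $Q$ is finite. Its run relation ${\to_A}\subseteq Q\times\mathsf{SP}(\Sigma)\times Q$ is the smallest relation such that: $q\xrightarrow{1}_A q$; if $q'\in\delta(q,a)$ then $q\xrightarrow{a}_A q'$; if $q\xrightarrow{U}_A q''$ and $q''\xrightarrow{V}_A q'$ then $q\xrightarrow{U\cdot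 V}_A q'$; and if $n\ge 0$, $r_i\xrightarrow{U_i}_A r_i'\in F$ for $1\le i\le n$ and $q'\in\gamma(q,\{\!|r_1,\dots,r_n|\!\})$, then $q\xrightarrow{U_1\parallel\cdots\parallel U_n}_A q'$. The language of $q$ is $L_A(q)=\{U\in\mathsf{SP}(\Sigma) : \exists q'\in F,\ q\xrightarrow{U}_A q'\}$. The support relation $\preceq_A$ is the smallest preorder on $Q$ such that $q'\preceq_A q$ whenever $q'\in\delta(q,a)$ for some $a\in\Sigma$, or $q'\in\gamma(q,\phi)$ for some $\phi$, or $q'\in\phi$ for some $\phi$ with $\gamma(q,\phi)\neq\emptyset$. $A$ is fork-acyclic if, whenever $r\in\phi$ and $\gamma(q,\phi)\neq\emptyset$, we have $r\preceq_A q$ and $q\not\preceq_A r$. $A$ is well-structured if, whenever $\gamma(q,\phi)\neq\emptyset$, we have $|\phi|\ge 2$ and every $r\in\phi$ satisfies $r\notin F$ and $\gamma(r,\psi)\cap F=\emptyset$ for all $\psi\in\mathbb{M}(Q)$. Theorem. Given a finite, fork-acyclic and well-structured pomset automaton $A$ and states $q_1,q_2$ of $A$, it is decidable whether $L_A(q_1)=L_A(q_2)$.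 That is, there is a single computable function which, on input a finite description of any such automaton (the numbers of states and letters, and the lists of accepting states, sequential transitions and fork transitions, with states and letters numbered) together with the numbers of two states $q_1,q_2$, returns $\mathsf{true}$ if and only if $L_A(q_1)=L_A(q_2)$. -/

import Mathlib

universe u v

/-! ## Pomsets -/

/-- A labelled partially ordered set over the alphabet `S`. -/
structure LabelledPoset (S : Type u) where
  carrier : Type
  [order : PartialOrder carrier]
  label : carrier → S

attribute [instance] LabelledPoset.order

namespace LabelledPoset

variable {S : Type u}

/-- Two labelled posets are isomorphic when an order isomorphism preserves the labels. -/
def Iso (u v : LabelledPoset S) : Prop :=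
  ∃ h : u.carrier ≃o v.carrier, ∀ x, v.label (h x) = u.label x

instance isoSetoid (S : Type u) : Setoid (LabelledPoset S) where
  r := Iso
  iseqv :=
    { refl := fun u => ⟨OrderIso.refl _, fun _ => rfl⟩
      symm := fun {u v} ⟨h, hl⟩ => ⟨h.symm, fun x => by rw [← hl, h.apply_symm_apply]⟩
      trans := fun {u v w} ⟨h, hl⟩ ⟨k, kl⟩ => ⟨h.trans k, fun x => by
        rw [OrderIso.trans_apply, kl, hl]⟩ }

/-- The labelled poset without events. -/
def empty (S : Type u) : LabelledPoset S where
  carrier := Empty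
  label := fun x => x.elim

/-- The labelled poset with exactly one event, labelled by `a`. -/
def single (a : S) : LabelledPoset S where
  carrier := Unit
  label := fun _ => a

/-- Sequential composition: the disjoint union in which all events of `u` lie below all events
of `v`. -/
def seq (u v : LabelledPoset S) : LabelledPoset S where
  carrier := u.carrier ⊕ₗ v.carrier
  label := fun x => Sum.elim u.label v.label (ofLex x)

/-- Parallel composition: the disjoint union in which events of `u` and events of `v` are
incomparable. -/
def par (u v : LabelledPoset S) : LabelledPoset S where
  carrier := u.carrier ⊕ v.carrier
  label := Sum.elim u.label v.label

theorem seq_congr {u u' v v' : LabelledPoset S} (hu : u ≈ u') (hv : v ≈ v') :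
    seq u v ≈ seq u' v' := by
  obtain ⟨h, hl⟩ := hu
  obtain ⟨k, kl⟩ := hv
  refine ⟨h.sumLexCongr k, fun x => ?_⟩
  rcases x with x | x
  · exact hl x
  · exact kl x

theorem par_congr {u u' v v' : LabelledPoset S} (hu : u ≈ u') (hv : v ≈ v') :
    par u v ≈ par u' v' := by
  obtain ⟨h, hl⟩ := hu
  obtain ⟨k, kl⟩ := hv
  refine ⟨h.sumCongr k, fun x => ?_⟩
  rcases x with x | x
  · exact hl x
  · exact kl x

end LabelledPoset

/-- A pomset over `S`: an isomorphism class of labelled posets. -/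
def Pomset (S : Type u) : Type (max 1 u) := Quotient (LabelledPoset.isoSetoid S)

namespace Pomset

variable {S : Type u}

/-- The empty pomset, written `1` on paper. -/
def empty : Pomset S := Quotient.mk _ (LabelledPoset.empty S)

/-- The primitive pomset with one event, labelled by `a`. -/
def prim (a : S) : Pomset S := Quotient.mk _ (LabelledPoset.single a)

/-- Sequential composition of pomsets. -/
def seq : Pomset S → Pomset S → Pomset S :=
  Quotient.map₂ LabelledPoset.seq fun _ _ hu _ _ hv => LabelledPoset.seq_congr hu hv

/-- Parallel composition of pomsets. -/
def par : Pomset S → Pomset S → Pomset S :=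
  Quotient.map₂ LabelledPoset.par fun _ _ hu _ _ hv => LabelledPoset.par_congr hu hv

/-- The parallel composition `U₁ ∥ ⋯ ∥ Uₙ`; it is the empty pomset for the empty list. -/
def parList (l : List (Pomset S)) : Pomset S := l.foldr par empty

/-- The series-parallel pomsets: the smallest set that contains the empty pomset and the primitive
pomsets and that is closed under sequential and parallel composition. -/
inductive IsSP : Pomset S → Prop
  | empty : IsSP Pomset.empty
  | prim (a : S) : IsSP (Pomset.prim a)
  | seq {U V : Pomset S} : IsSP U → IsSP V → IsSP (Pomset.seq U V)
  | par {U V : Pomset S} : IsSP U → IsSP V → IsSP (Pomset.par U V)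

end Pomset

/-! ## Pomset automata -/

/-- A pomset automaton over the alphabet `S` with states `Q`. -/
structure PomsetAutomaton (S : Type u) (Q : Type v) where
  /-- the accepting states -/
  F : Set Q
  /-- the sequential transition function -/
  δ : Q → S → Set Q
  /-- the parallel transition function; the second argument is a finite multiset of states -/
  γ : Q → Multiset Q → Set Q
  finite_forks : ∀ q, {φ : Multiset Q | (γ q φ).Nonempty}.Finite

namespace PomsetAutomaton

variable {S : Type u} {Q : Type v}

/-- The run relation: `A.Run q U q'` says that `A` can read `U` while going from `q` to `q'`. -/
inductive Run (A : PomsetAutomaton S Q) : Q → Pomset S → Q → Prop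
  | trivial (q : Q) : Run A q Pomset.empty q
  | letter {q q' : Q} {a : S} : q' ∈ A.δ q a → Run A q (Pomset.prim a) q'
  | comp {q q'' q' : Q} {U V : Pomset S} :
      Run A q U q'' → Run A q'' V q' → Run A q (Pomset.seq U V) q'
  | fork {q q' : Q} {n : ℕ} (r r' : Fin n → Q) (U : Fin n → Pomset S) :
      (∀ i, Run A (r i) (U i) (r' i)) → (∀ i, r' i ∈ A.F) →
      q' ∈ A.γ q (List.ofFn r : Multiset Q) →
      Run A q (Pomset.parList (List.ofFn U)) q'

/-- The language of a state: the sp-pomsets that can be read from `q` to an accepting state. -/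
def language (A : PomsetAutomaton S Q) (q : Q) : Set (Pomset S) :=
  {U | U.IsSP ∧ ∃ q' ∈ A.F, A.Run q U q'}

/-- `A.IsForkTarget q r`: the state `r` is a fork target of the state `q`. -/
def IsForkTarget (A : PomsetAutomaton S Q) (q r : Q) : Prop :=
  ∃ φ : Multiset Q, r ∈ φ ∧ (A.γ q φ).Nonempty

/-- The generating pairs of the support relation. -/
def DirectSupport (A : PomsetAutomaton S Q) (q' q : Q) : Prop :=
  (∃ a, q' ∈ A.δ q a) ∨ (∃ φ, q' ∈ A.γ q φ) ∨ A.IsForkTarget q q'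

/-- The support relation: `A.Supports q' q` means that `q'` supports `q`. It is the smallest
preorder that contains the generating pairs. -/
def Supports (A : PomsetAutomaton S Q) : Q → Q → Prop :=
  Relation.ReflTransGen A.DirectSupport

/-- The strict support relation. -/
def StrictlySupports (A : PomsetAutomaton S Q) (q' q : Q) : Prop :=
  A.Supports q' q ∧ ¬ A.Supports q q'

/-- Every fork target of a state strictly supports that state. -/
def ForkAcyclic (A : PomsetAutomaton S Q) : Prop :=
  ∀ q r, A.IsForkTarget q r → A.StrictlySupports r q

/-- Every fork that can take place has at least two threads, and no state into which it forks is
accepting or can reach an accepting state by a single fork transition. -/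
def WellStructured (A : PomsetAutomaton S Q) : Prop :=
  ∀ (q : Q) (φ : Multiset Q), (A.γ q φ).Nonempty →
    2 ≤ Multiset.card φ ∧
    ∀ r ∈ φ, r ∉ A.F ∧ ∀ ψ : Multiset Q, Disjoint (A.γ r ψ) A.F

end PomsetAutomaton

/-! ## Finite pomset automata as inputs of algorithms -/

/-- A finite description of a finite pomset automaton over a finite alphabet, in which states and
letters are numbered. Its components are the number of states, the number of letters, the list of
accepting states, the list of sequential transitions (source, letter, target), and the list of fork
transitions (source, list of the states forked into, target). -/
abbrev PACode : Type := ℕ × ℕ × List ℕ × List (ℕ × ℕ × ℕ) × List (ℕ × List ℕ × ℕ)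

namespace PACode

def numStates (c : PACode) : ℕ := c.1

def numLetters (c : PACode) : ℕ := c.2.1

def accepting (c : PACode) : List ℕ := c.2.2.1

def seqTrans (c : PACode) : List (ℕ × ℕ × ℕ) := c.2.2.2.1

def forkTrans (c : PACode) : List (ℕ × List ℕ × ℕ) := c.2.2.2.2

/-- `c` describes the automaton `A`, where the states and the letters are numbered by the bijections
`st` and `lt`. A fork multiset is described by any of its enumerations as a list; entries of the
lists with a number out of range have no meaning. -/
structure Encodes (c : PACode) {S : Type u} {Q : Type v} (A : PomsetAutomaton S Q)
    (st : Q ≃ Fin c.numStates) (lt : S ≃ Fin c.numLetters) : Prop where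
  accepting_iff : ∀ q, q ∈ A.F ↔ (st q : ℕ) ∈ c.accepting
  seqTrans_iff : ∀ q a q', q' ∈ A.δ q a ↔ ((st q : ℕ), (lt a : ℕ), (st q' : ℕ)) ∈ c.seqTrans
  forkTrans_iff : ∀ q (φ : Multiset Q) q', q' ∈ A.γ q φ ↔
    ∃ l : List ℕ, (l : Multiset ℕ) = φ.map (fun r => (st r : ℕ)) ∧
      ((st q : ℕ), l, (st q' : ℕ)) ∈ c.forkTrans

/-- Every finite pomset automaton over a finite alphabet has a description. -/
theorem exists_encodes {S : Type u} {Q : Type v} [Finite S] [Finite Q]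
    (A : PomsetAutomaton S Q) :
    ∃ (c : PACode) (st : Q ≃ Fin c.numStates) (lt : S ≃ Fin c.numLetters), c.Encodes A st lt := by
  classical
  obtain ⟨n, ⟨st⟩⟩ := Finite.exists_equiv_fin Q
  obtain ⟨k, ⟨lt⟩⟩ := Finite.exists_equiv_fin S
  have hinj : Function.Injective (fun q : Q => (st q : ℕ)) :=
    Fin.val_injective.comp st.injective
  have hinjS : Function.Injective (fun a : S => (lt a : ℕ)) :=
    Fin.val_injective.comp lt.injective
  have hF : ((fun q : Q => (st q : ℕ)) '' A.F).Finite := A.F.toFinite.image _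
  have hδ : ((fun t : Q × S × Q => ((st t.1 : ℕ), (lt t.2.1 : ℕ), (st t.2.2 : ℕ))) ''
      {t | t.2.2 ∈ A.δ t.1 t.2.1}).Finite := (Set.toFinite _).image _
  have hT : {t : Q × Multiset Q × Q | t.2.2 ∈ A.γ t.1 t.2.1}.Finite := by
    have h1 : (⋃ q, {φ : Multiset Q | (A.γ q φ).Nonempty}).Finite :=
      Set.finite_iUnion A.finite_forks
    refine ((Set.finite_univ (α := Q)).prod (h1.prod (Set.finite_univ (α := Q)))).subset ?_
    rintro ⟨q, φ, q'⟩ h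
    exact ⟨trivial, Set.mem_iUnion.2 ⟨q, ⟨q', h⟩⟩, trivial⟩
  have hγ := hT.image (fun t : Q × Multiset Q × Q =>
    ((st t.1 : ℕ), (t.2.1.map (fun r => (st r : ℕ))).toList, (st t.2.2 : ℕ)))
  refine ⟨(n, k, hF.toFinset.toList, hδ.toFinset.toList, hγ.toFinset.toList), st, lt, ?_, ?_, ?_⟩
  · intro q
    simp only [accepting, Finset.mem_toList, Set.Finite.mem_toFinset]
    exact (hinj.mem_set_image).symm
  · intro q a q'
    simp only [seqTrans, Finset.mem_toList, Set.Finite.mem_toFinset]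
    constructor
    · exact fun h => ⟨(q, a, q'), h, rfl⟩
    · rintro ⟨⟨p, b, p'⟩, h, he⟩
      simp only [Prod.mk.injEq] at he
      obtain ⟨h1, h2, h3⟩ := he
      obtain rfl := hinj h1
      obtain rfl := hinjS h2
      obtain rfl := hinj h3
      exact h
  · intro q φ q'
    simp only [forkTrans, Finset.mem_toList, Set.Finite.mem_toFinset]
    constructor
    · exact fun h => ⟨_, Multiset.coe_toList _, (q, φ, q'), h, rfl⟩
    · rintro ⟨l, hl, ⟨p, ψ, p'⟩, h, he⟩
      simp only [Prod.mk.injEq] at he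
      obtain ⟨h1, h2, h3⟩ := he
      obtain rfl := hinj h1
      obtain rfl := hinj h3
      rw [← h2, Multiset.coe_toList] at hl
      obtain rfl := Multiset.map_injective hinj hl
      exact h

end PACode

/-! Assign to a pomset its behaviour, the set of pairs of states joined by a run on it. Acceptance
depends only on behaviours, and a finite automaton has finitely many of them, so it suffices to
compute the behaviours of all series-parallel pomsets and to compare the two states on each.

This needs behaviours to be compositional, which well-structuredness provides. Threads are not
accepting, so each thread of a fork reads a nonempty pomset, a fork reads a proper parallel
composition, and runs on the empty pomset stay put. With Levi's lemma the behaviour of `U · V` is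
then the relational composition (`run_seq_iff`). A thread cannot reach acceptance by a single fork
either, so threads accept only parallel-prime pomsets. Factorisation into parallel primes is unique
up to order (`perm_of_parList_eq`), so the threads of a fork match the prime factors one to one, and
the behaviour of a product of at least two primes is determined by those of its factors
(`run_parList_iff`).

Arbitrary parallel compositions are not computed from the behaviours of their two halves. Hence
saturation marks the behaviours of primes and combines lists of these; lists longer than every fork
give the empty behaviour, so bounded lengths suffice. -/

/-! ### Pomset algebra: decompositions as subsets of one poset -/

namespace LabelledPoset

variable {S : Type u}

/-- The labelled poset induced on a set of events. -/
def restrict (P : LabelledPoset S) (s : Set P.carrier) : LabelledPoset S where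
  carrier := s
  label := fun x => P.label x

theorem iso_restrict_range {X P : LabelledPoset S} (f : X.carrier ↪o P.carrier)
    (hf : ∀ x, P.label (f x) = X.label x) : X ≈ P.restrict (Set.range f) :=
  ⟨f.orderIso, fun x => hf x⟩

end LabelledPoset

namespace Pomset

variable {S : Type u}

/-- The pomset induced by a labelled poset on a set of events. -/
def part (P : LabelledPoset S) (s : Set P.carrier) : Pomset S :=
  Quotient.mk _ (P.restrict s)

theorem mk_eq_part_range {X P : LabelledPoset S} (f : X.carrier ↪o P.carrier)
    (hf : ∀ x, P.label (f x) = X.label x) : (Quotient.mk _ X : Pomset S) = part P (Set.range f) :=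
  Quotient.sound (LabelledPoset.iso_restrict_range f hf)

theorem part_univ (P : LabelledPoset S) : part P Set.univ = Quotient.mk _ P := by
  rw [mk_eq_part_range (RelEmbedding.refl _) (fun _ => rfl)]
  congr
  exact Set.range_id.symm

theorem part_union_seq (P : LabelledPoset S) {a b : Set P.carrier}
    (h : ∀ x ∈ a, ∀ y ∈ b, x < y) : part P (a ∪ b) = seq (part P a) (part P b) := by
  let f : ((P.restrict a).seq (P.restrict b)).carrier ↪o P.carrier :=
    OrderEmbedding.ofMapLEIff (fun x => Sum.elim (fun x : a => (x : P.carrier))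
      (fun x : b => (x : P.carrier)) (ofLex x)) (by
        rintro (⟨x, hx⟩ | ⟨x, hx⟩) (⟨y, hy⟩ | ⟨y, hy⟩)
        · exact (Sum.Lex.inl_le_inl_iff (α := a) (β := b)).symm
        · exact iff_of_true (h x hx y hy).le (Sum.Lex.inl_le_inr _ _)
        · exact iff_of_false (h y hy x hx).not_ge Sum.Lex.not_inr_le_inl
        · exact (Sum.Lex.inr_le_inr_iff (α := a) (β := b)).symm)
  have hf := mk_eq_part_range f (by rintro (x | x) <;> rfl)
  have hr : Set.range f = a ∪ b := by
    ext x
    constructor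
    · rintro ⟨⟨y, hy⟩ | ⟨y, hy⟩, rfl⟩
      exacts [Or.inl hy, Or.inr hy]
    · rintro (hx | hx)
      exacts [⟨toLex (Sum.inl ⟨x, hx⟩), rfl⟩, ⟨toLex (Sum.inr ⟨x, hx⟩), rfl⟩]
  rw [hr] at hf
  exact hf.symm

theorem part_union_par (P : LabelledPoset S) {a b : Set P.carrier}
    (h : ∀ x ∈ a, ∀ y ∈ b, ¬ x ≤ y ∧ ¬ y ≤ x) :
    part P (a ∪ b) = par (part P a) (part P b) := by
  let f : ((P.restrict a).par (P.restrict b)).carrier ↪o P.carrier :=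
    OrderEmbedding.ofMapLEIff (Sum.elim (fun x : a => (x : P.carrier))
      (fun x : b => (x : P.carrier))) (by
        rintro (⟨x, hx⟩ | ⟨x, hx⟩) (⟨y, hy⟩ | ⟨y, hy⟩)
        · exact (Sum.inl_le_inl_iff (α := a) (β := b)).symm
        · exact iff_of_false (h x hx y hy).1 Sum.not_inl_le_inr
        · exact iff_of_false (h y hy x hx).2 Sum.not_inr_le_inl
        · exact (Sum.inr_le_inr_iff (α := a) (β := b)).symm)
  have hf := mk_eq_part_range f (by rintro (x | x) <;> rfl)
  have hr : Set.range f = a ∪ b := by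
    ext x
    constructor
    · rintro ⟨⟨y, hy⟩ | ⟨y, hy⟩, rfl⟩
      exacts [Or.inl hy, Or.inr hy]
    · rintro (hx | hx)
      exacts [⟨Sum.inl ⟨x, hx⟩, rfl⟩, ⟨Sum.inr ⟨x, hx⟩, rfl⟩]
  rw [hr] at hf
  exact hf.symm

/-- Moves a decomposition into subsets of one fixed poset, so that two decompositions of the same
pomset can be compared by set algebra. -/
theorem exists_part_of_mk_eq_seq {P : LabelledPoset S} {U V : Pomset S}
    (h : (Quotient.mk _ P : Pomset S) = seq U V) :
    ∃ a b : Set P.carrier, a ∪ b = Set.univ ∧ (∀ x ∈ a, ∀ y ∈ b, x < y) ∧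
      U = part P a ∧ V = part P b := by
  induction U using Quotient.inductionOn with | _ X
  induction V using Quotient.inductionOn with | _ Y
  obtain ⟨e, he⟩ := Quotient.exact h.symm
  refine ⟨_, _, ?_, ?_, mk_eq_part_range
    (OrderEmbedding.ofMapLEIff (fun x : X.carrier => e (toLex (Sum.inl x)))
      fun x y => e.le_iff_le.trans Sum.Lex.inl_le_inl_iff) (fun x => he _),
    mk_eq_part_range (OrderEmbedding.ofMapLEIff (fun x : Y.carrier => e (toLex (Sum.inr x)))
      fun x y => e.le_iff_le.trans Sum.Lex.inr_le_inr_iff) (fun x => he _)⟩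
  · refine Set.eq_univ_of_forall fun p => ?_
    obtain ⟨x | x, rfl⟩ := e.surjective p
    exacts [Or.inl ⟨x, rfl⟩, Or.inr ⟨x, rfl⟩]
  · rintro _ ⟨x, rfl⟩ _ ⟨y, rfl⟩
    exact e.lt_iff_lt.2 (Sum.Lex.inl_lt_inr _ _)

theorem exists_part_of_mk_eq_par {P : LabelledPoset S} {U V : Pomset S}
    (h : (Quotient.mk _ P : Pomset S) = par U V) :
    ∃ a b : Set P.carrier, a ∪ b = Set.univ ∧ (∀ x ∈ a, ∀ y ∈ b, ¬ x ≤ y ∧ ¬ y ≤ x) ∧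
      U = part P a ∧ V = part P b := by
  induction U using Quotient.inductionOn with | _ X
  induction V using Quotient.inductionOn with | _ Y
  obtain ⟨e, he⟩ := Quotient.exact h.symm
  refine ⟨_, _, ?_, ?_, mk_eq_part_range
    (OrderEmbedding.ofMapLEIff (fun x : X.carrier => e (Sum.inl x))
      fun x y => e.le_iff_le.trans Sum.inl_le_inl_iff) (fun x => he _),
    mk_eq_part_range (OrderEmbedding.ofMapLEIff (fun x : Y.carrier => e (Sum.inr x))
      fun x y => e.le_iff_le.trans Sum.inr_le_inr_iff) (fun x => he _)⟩
  · refine Set.eq_univ_of_forall fun p => ?_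
    obtain ⟨x | x, rfl⟩ := e.surjective p
    exacts [Or.inl ⟨x, rfl⟩, Or.inr ⟨x, rfl⟩]
  · rintro _ ⟨x, rfl⟩ _ ⟨y, rfl⟩
    exact ⟨fun h => Sum.not_inl_le_inr (e.le_iff_le.1 h),
      fun h => Sum.not_inr_le_inl (e.le_iff_le.1 h)⟩

theorem part_eq_empty_iff {P : LabelledPoset S} {s : Set P.carrier} :
    part P s = empty ↔ s = ∅ := by
  constructor
  · intro h
    obtain ⟨e, -⟩ := Quotient.exact h
    exact Set.eq_empty_of_forall_notMem fun x hx => (e ⟨x, hx⟩).elim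
  · rintro rfl
    exact Quotient.sound ⟨⟨⟨fun x => x.2.elim, fun x => x.elim, fun x => x.2.elim,
      fun x => x.elim⟩, fun {x} => x.2.elim⟩, fun x => x.2.elim⟩

theorem prim_ne_empty (a : S) : prim a ≠ empty := fun h => by
  obtain ⟨e, -⟩ := Quotient.exact h
  exact (e ()).elim

theorem prim_injective : Function.Injective (prim : S → Pomset S) := fun a b h => by
  obtain ⟨e, he⟩ := Quotient.exact h
  exact (he ()).symm

theorem exists_eq_mk (U : Pomset S) : ∃ P : LabelledPoset S, U = Quotient.mk _ P :=
  (Quotient.exists_rep U).imp fun _ h => h.symm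

theorem empty_seq (U : Pomset S) : seq empty U = U := by
  obtain ⟨P, rfl⟩ := exists_eq_mk U
  rw [← part_univ, ← part_eq_empty_iff.2 (rfl : (∅ : Set P.carrier) = ∅),
    ← part_union_seq _ (by simp), Set.empty_union]

theorem seq_empty (U : Pomset S) : seq U empty = U := by
  obtain ⟨P, rfl⟩ := exists_eq_mk U
  rw [← part_univ, ← part_eq_empty_iff.2 (rfl : (∅ : Set P.carrier) = ∅),
    ← part_union_seq _ (by simp), Set.union_empty]

theorem empty_par (U : Pomset S) : par empty U = U := by
  obtain ⟨P, rfl⟩ := exists_eq_mk U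
  rw [← part_univ, ← part_eq_empty_iff.2 (rfl : (∅ : Set P.carrier) = ∅),
    ← part_union_par _ (by simp), Set.empty_union]

theorem par_empty (U : Pomset S) : par U empty = U := by
  obtain ⟨P, rfl⟩ := exists_eq_mk U
  rw [← part_univ, ← part_eq_empty_iff.2 (rfl : (∅ : Set P.carrier) = ∅),
    ← part_union_par _ (by simp), Set.union_empty]

theorem par_assoc (U V W : Pomset S) : par (par U V) W = par U (par V W) := by
  induction U using Quotient.inductionOn with | _ X
  induction V using Quotient.inductionOn with | _ Y
  induction W using Quotient.inductionOn with | _ Z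
  exact Quotient.sound ⟨OrderIso.sumAssoc _ _ _, by rintro ((x | x) | x) <;> rfl⟩

/-- Levi's lemma for sequential composition. -/
theorem levi {X Y U V : Pomset S} (h : seq X Y = seq U V) :
    ∃ Z, (X = seq U Z ∧ V = seq Z Y) ∨ (U = seq X Z ∧ Y = seq Z V) := by
  obtain ⟨P, hP⟩ := exists_eq_mk (seq X Y)
  obtain ⟨a, b, hab, hlt, rfl, rfl⟩ := exists_part_of_mk_eq_seq hP.symm
  obtain ⟨c, d, hcd, hlt', rfl, rfl⟩ := exists_part_of_mk_eq_seq (hP.symm.trans h)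
  have hab' : ∀ x, x ∈ a ∨ x ∈ b := fun x => Set.eq_univ_iff_forall.1 hab x
  have hcd' : ∀ x, x ∈ c ∨ x ∈ d := fun x => Set.eq_univ_iff_forall.1 hcd x
  have hb : ∀ x ∈ a, x ∉ b := fun x h h' => lt_irrefl _ (hlt x h x h')
  have hd : ∀ x ∈ c, x ∉ d := fun x h h' => lt_irrefl _ (hlt' x h x h')
  by_cases hs : a ⊆ c
  · refine ⟨part P (c ∩ b), Or.inr ⟨?_, ?_⟩⟩
    · rw [← part_union_seq _ fun x hx y hy => hlt x hx y hy.2]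
      congr 1
      ext x
      have := @hs x
      grind
    · rw [← part_union_seq _ fun x hx y hy => hlt' x hx.1 y hy]
      congr 1
      ext x
      have := @hs x
      grind
  -- Two cuts are nested: a point `z` of `a` outside `c` lies above all of `c` and below all of `b`,
  -- so `c` avoids `b`.
  · obtain ⟨z, hza, hzc⟩ := Set.not_subset.1 hs
    have hs' : ∀ x ∈ c, x ∈ a := fun x hx => (hab' x).resolve_right fun hxb =>
      lt_asymm (hlt z hza x hxb) (hlt' x hx z ((hcd' z).resolve_left hzc))
    refine ⟨part P (a ∩ d), Or.inl ⟨?_, ?_⟩⟩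
    · rw [← part_union_seq _ fun x hx y hy => hlt' x hx y hy.2]
      congr 1
      ext x
      have := hs' x
      grind
    · rw [← part_union_seq _ fun x hx y hy => hlt x hx.1 y hy]
      congr 1
      ext x
      have := hs' x
      grind

/-- The refinement property of parallel composition. -/
theorem par_refinement {X Y U V : Pomset S} (h : par X Y = par U V) :
    ∃ E F G H, X = par E F ∧ Y = par G H ∧ U = par E G ∧ V = par F H := by
  obtain ⟨P, hP⟩ := exists_eq_mk (par X Y)
  obtain ⟨a, b, hab, hi, rfl, rfl⟩ := exists_part_of_mk_eq_par hP.symm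
  obtain ⟨c, d, hcd, hi', rfl, rfl⟩ := exists_part_of_mk_eq_par (hP.symm.trans h)
  refine ⟨part P (a ∩ c), part P (a ∩ d), part P (b ∩ c), part P (b ∩ d), ?_, ?_, ?_, ?_⟩
  · rw [← part_union_par _ fun x hx y hy => hi' x hx.2 y hy.2, ← Set.inter_union_distrib_left,
      hcd, Set.inter_univ]
  · rw [← part_union_par _ fun x hx y hy => hi' x hx.2 y hy.2, ← Set.inter_union_distrib_left,
      hcd, Set.inter_univ]
  · rw [← part_union_par _ fun x hx y hy => hi x hx.1 y hy.1, ← Set.union_inter_distrib_right,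
      hab, Set.univ_inter]
  · rw [← part_union_par _ fun x hx y hy => hi x hx.1 y hy.1, ← Set.union_inter_distrib_right,
      hab, Set.univ_inter]

/-- Points from different parallel parts are incomparable, so they lie on the same side of the
sequential cut. If both parts are inhabited, this puts all points on one side. -/
theorem eq_empty_of_par_eq_seq {X Y U V : Pomset S} (h : par X Y = seq U V) :
    (X = empty ∨ Y = empty) ∨ (U = empty ∨ V = empty) := by
  obtain ⟨P, hP⟩ := exists_eq_mk (par X Y)
  obtain ⟨a, b, hab, hi, rfl, rfl⟩ := exists_part_of_mk_eq_par hP.symm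
  obtain ⟨c, d, hcd, hlt, rfl, rfl⟩ := exists_part_of_mk_eq_seq (hP.symm.trans h)
  simp only [part_eq_empty_iff]
  have hab' : ∀ x, x ∈ a ∨ x ∈ b := fun x => Set.eq_univ_iff_forall.1 hab x
  have hcd' : ∀ x, x ∈ c ∨ x ∈ d := fun x => Set.eq_univ_iff_forall.1 hcd x
  have h1 : ∀ x ∈ a, ∀ y ∈ b, ¬ (x ∈ c ∧ y ∈ d) := fun x hx y hy h =>
    (hi x hx y hy).1 (hlt x h.1 y h.2).le
  have h2 : ∀ x ∈ a, ∀ y ∈ b, ¬ (y ∈ c ∧ x ∈ d) := fun x hx y hy h =>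
    (hi x hx y hy).2 (hlt y h.1 x h.2).le
  by_contra! hne
  obtain ⟨⟨⟨x, hx⟩, ⟨y, hy⟩⟩, ⟨⟨z, hz⟩, ⟨w, hw⟩⟩⟩ := hne
  grind

theorem eq_empty_of_prim_eq_seq {a : S} {U V : Pomset S} (h : prim a = seq U V) :
    U = empty ∨ V = empty := by
  obtain ⟨s, t, -, hlt, rfl, rfl⟩ := exists_part_of_mk_eq_seq (P := .single a) h
  simp only [part_eq_empty_iff]
  by_contra! hne
  obtain ⟨⟨x, hx⟩, ⟨y, hy⟩⟩ := hne
  exact lt_irrefl (() : Unit) (hlt x hx y hy)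

theorem eq_empty_of_prim_eq_par {a : S} {U V : Pomset S} (h : prim a = par U V) :
    U = empty ∨ V = empty := by
  obtain ⟨s, t, -, hi, rfl, rfl⟩ := exists_part_of_mk_eq_par (P := .single a) h
  simp only [part_eq_empty_iff]
  by_contra! hne
  obtain ⟨⟨x, hx⟩, ⟨y, hy⟩⟩ := hne
  exact (hi x hx y hy).1 (le_refl (() : Unit))

theorem seq_eq_empty_iff {U V : Pomset S} : seq U V = empty ↔ U = empty ∧ V = empty := by
  constructor
  · intro h
    obtain ⟨s, t, -, -, rfl, rfl⟩ := exists_part_of_mk_eq_seq (P := .empty S) h.symm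
    simp only [part_eq_empty_iff]
    exact ⟨Set.eq_empty_of_forall_notMem fun x => x.elim,
      Set.eq_empty_of_forall_notMem fun x => x.elim⟩
  · rintro ⟨rfl, rfl⟩
    exact seq_empty _

theorem par_eq_empty_iff {U V : Pomset S} : par U V = empty ↔ U = empty ∧ V = empty := by
  constructor
  · intro h
    obtain ⟨s, t, -, -, rfl, rfl⟩ := exists_part_of_mk_eq_par (P := .empty S) h.symm
    simp only [part_eq_empty_iff]
    exact ⟨Set.eq_empty_of_forall_notMem fun x => x.elim,
      Set.eq_empty_of_forall_notMem fun x => x.elim⟩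
  · rintro ⟨rfl, rfl⟩
    exact par_empty _

/-! ### Unique factorisation into parallel primes -/

/-- A pomset is parallel-prime if it is nonempty and not a parallel composition of two nonempty
pomsets. -/
def ParPrime (U : Pomset S) : Prop :=
  U ≠ empty ∧ ∀ X Y, U = par X Y → X = empty ∨ Y = empty

theorem parPrime_prim (a : S) : ParPrime (prim a) :=
  ⟨prim_ne_empty a, fun _ _ => eq_empty_of_prim_eq_par⟩

theorem parPrime_seq {U V : Pomset S} (hU : U ≠ empty) (hV : V ≠ empty) : ParPrime (seq U V) :=
  ⟨fun h => hU (seq_eq_empty_iff.1 h).1, fun _ _ h =>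
    (eq_empty_of_par_eq_seq h.symm).resolve_right (by simp [hU, hV])⟩

theorem parList_append (l m : List (Pomset S)) :
    parList (l ++ m) = par (parList l) (parList m) := by
  induction l with
  | nil => exact (empty_par _).symm
  | cons a l ih =>
    change par a (parList (l ++ m)) = par (par a (parList l)) _
    rw [ih, par_assoc]

theorem parList_singleton (U : Pomset S) : parList [U] = U := par_empty U

theorem parList_eq_empty_iff {l : List (Pomset S)} : parList l = empty ↔ ∀ U ∈ l, U = empty := by
  induction l with
  | nil => simp [parList]
  | cons a l ih =>
    change par a (parList l) = empty ↔ _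
    rw [par_eq_empty_iff, ih, List.forall_mem_cons]

theorem exists_par_of_two_le_length {l : List (Pomset S)} (h2 : 2 ≤ l.length)
    (hne : ∀ U ∈ l, U ≠ empty) : ∃ X Y, parList l = par X Y ∧ X ≠ empty ∧ Y ≠ empty := by
  match l, h2 with
  | a :: b :: l, _ =>
    refine ⟨a, parList (b :: l), rfl, hne a (by simp), fun h => ?_⟩
    exact hne b (by simp) (parList_eq_empty_iff.1 h b (by simp))

open Classical in
theorem mem_and_eq_parList_erase {a : Pomset S} (ha : ParPrime a) {l : List (Pomset S)}
    (hl : ∀ U ∈ l, ParPrime U) {H : Pomset S} (h : parList l = par a H) :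
    a ∈ l ∧ H = parList (l.erase a) := by
  induction l generalizing H with
  | nil => exact absurd (par_eq_empty_iff.1 h.symm).1 ha.1
  | cons c l ih =>
    have hc := hl c (by simp)
    obtain ⟨E, F, G, K, rfl, hL, rfl, rfl⟩ := par_refinement (X := c) (Y := parList l) h
    -- If `E` is empty, `a` is `G` and sits in the tail. If `F` is empty, primality of `a` makes `G`
    -- empty, and `a` is the head.
    rcases hc.2 E F rfl with rfl | rfl
    · simp only [empty_par] at *
      obtain ⟨h1, h2⟩ := ih (fun U hU => hl U (by simp [hU])) hL
      refine ⟨by simp [h1], ?_⟩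
      -- When the head is another copy of `a`, `erase` removes the head instead of the copy in the
      -- tail.
      by_cases e : F = G
      · subst e
        rw [List.erase_cons_head, hL]
      · rw [List.erase_cons_tail (by simpa using e), h2]
        rfl
    · rcases ha.2 E G rfl with rfl | rfl
      · exact absurd (par_empty _) hc.1
      · simp only [par_empty, empty_par] at *
        simp [hL]

open Classical in
/-- Decompositions into parallel-prime pomsets are unique up to order. -/
theorem perm_of_parList_eq {l m : List (Pomset S)} (hl : ∀ U ∈ l, ParPrime U)
    (hm : ∀ U ∈ m, ParPrime U) (h : parList l = parList m) : l.Perm m := by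
  induction l generalizing m with
  | nil =>
    rcases m with _ | ⟨a, m⟩
    · rfl
    · exact absurd (parList_eq_empty_iff.1 h.symm a (by simp)) (hm a (by simp)).1
  | cons a l ih =>
    obtain ⟨h1, h2⟩ := mem_and_eq_parList_erase (hl a (by simp)) hm h.symm
    refine (List.Perm.cons a (ih (fun U hU => hl U (by simp [hU])) (fun U hU =>
      hm U (List.mem_of_mem_erase hU)) h2)).trans (List.perm_cons_erase h1).symm

end Pomset

/-! ### Runs of well-structured automata -/

namespace PomsetAutomaton

open Pomset

variable {S : Type u} {Q : Type v} {A : PomsetAutomaton S Q}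

theorem Run.isSP {q q' : Q} {U : Pomset S} (h : A.Run q U q') : U.IsSP := by
  induction h with
  | trivial q => exact .empty
  | letter h => exact .prim _
  | comp _ _ h₁ h₂ => exact .seq h₁ h₂
  | @fork q q' n r r' U hr hF hq ih =>
    have : ∀ l : List (Pomset S), (∀ U ∈ l, U.IsSP) → (parList l).IsSP := by
      intro l
      induction l with
      | nil => exact fun _ => .empty
      | cons a l ihl => exact fun hl => .par (hl a (by simp)) (ihl fun U hU => hl U (by simp [hU]))
    exact this _ (by simpa using ih)

/-- In a well-structured automaton, runs on the empty pomset do not change the state. -/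
theorem WellStructured.eq_of_run_empty (hA : A.WellStructured) {q q' : Q} {U : Pomset S}
    (h : A.Run q U q') (hU : U = empty) : q = q' := by
  induction h with
  | trivial q => rfl
  | letter h => exact absurd hU (prim_ne_empty _)
  | comp _ _ h₁ h₂ =>
    obtain ⟨e₁, e₂⟩ := seq_eq_empty_iff.1 hU
    exact (h₁ e₁).trans (h₂ e₂)
  | @fork q q' n r r' U hr hF hq ih =>
    obtain ⟨h2, hW⟩ := hA _ _ ⟨q', hq⟩
    have hn : 0 < n := by simpa using lt_of_lt_of_le Nat.zero_lt_two h2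
    -- A thread reading the empty pomset would stay at its start, which is not accepting.
    have h0 := ih ⟨0, hn⟩ (parList_eq_empty_iff.1 hU _ (by simp))
    have h1 := hF ⟨0, hn⟩
    rw [← h0] at h1
    exact absurd h1 (hW _ (by simp)).1

theorem WellStructured.run_empty_iff (hA : A.WellStructured) {q q' : Q} :
    A.Run q empty q' ↔ q = q' :=
  ⟨fun h => hA.eq_of_run_empty h rfl, by rintro rfl; exact .trivial q⟩

/-- `A.IsThread r`: some possible fork has `r` among its threads. -/
def IsThread (A : PomsetAutomaton S Q) (r : Q) : Prop := ∃ q, A.IsForkTarget q r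

theorem isThread_of_mem_γ {q q' : Q} {n : ℕ} {r : Fin n → Q}
    (h : q' ∈ A.γ q (List.ofFn r : Multiset Q)) (i : Fin n) : A.IsThread (r i) :=
  ⟨q, _, by simp, q', h⟩

theorem WellStructured.ne_empty_of_isThread (hA : A.WellStructured) {r r' : Q} {U : Pomset S}
    (hr : A.IsThread r) (h : A.Run r U r') (hF : r' ∈ A.F) : U ≠ empty := by
  rintro rfl
  obtain rfl := hA.run_empty_iff.1 h
  obtain ⟨q, φ, hφ, hq⟩ := hr
  exact ((hA q φ hq).2 r hφ).1 hF

theorem WellStructured.two_le (hA : A.WellStructured) {q q' : Q} {n : ℕ} {r : Fin n → Q}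
    (h : q' ∈ A.γ q (List.ofFn r : Multiset Q)) : 2 ≤ n := by
  simpa using (hA _ _ ⟨q', h⟩).1

/-- At least two threads, each reading something nonempty. This rules out a single fork on a letter
or on a proper sequential composition. -/
theorem WellStructured.exists_par (hA : A.WellStructured) {q q' : Q} {n : ℕ} {r r' : Fin n → Q}
    {U : Fin n → Pomset S} (hr : ∀ i, A.Run (r i) (U i) (r' i)) (hF : ∀ i, r' i ∈ A.F)
    (h : q' ∈ A.γ q (List.ofFn r : Multiset Q)) :
    ∃ X Y, parList (List.ofFn U) = par X Y ∧ X ≠ empty ∧ Y ≠ empty :=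
  exists_par_of_two_le_length (by simpa using hA.two_le h) <| by
    simpa using fun i => hA.ne_empty_of_isThread (isThread_of_mem_γ h i) (hr i) (hF i)

theorem WellStructured.run_prim_iff (hA : A.WellStructured) {q q' : Q} {a : S} :
    A.Run q (prim a) q' ↔ q' ∈ A.δ q a := by
  refine ⟨fun h => ?_, .letter⟩
  generalize hW : prim a = W at h
  induction h with
  | trivial q => exact absurd hW (prim_ne_empty a)
  | letter h => exact prim_injective hW ▸ h
  | comp h₁ h₂ ih₁ ih₂ =>
    rcases eq_empty_of_prim_eq_seq hW with rfl | rfl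
    · obtain rfl := hA.run_empty_iff.1 h₁
      exact ih₂ (hW.trans (empty_seq _))
    · obtain rfl := hA.run_empty_iff.1 h₂
      exact ih₁ (hW.trans (seq_empty _))
  | fork r r' W hr hF hq ih =>
    obtain ⟨X, Y, hXY, hX, hY⟩ := hA.exists_par hr hF hq
    exact absurd (eq_empty_of_prim_eq_par (hW.trans hXY)) (by simp [hX, hY])

theorem WellStructured.run_seq_iff (hA : A.WellStructured) {q q' : Q} {U V : Pomset S} :
    A.Run q (seq U V) q' ↔ ∃ q'', A.Run q U q'' ∧ A.Run q'' V q' := by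
  refine ⟨fun h => ?_, fun ⟨_, h₁, h₂⟩ => .comp h₁ h₂⟩
  generalize hW : seq U V = W at h
  induction h generalizing U V with
  | trivial q =>
    obtain ⟨rfl, rfl⟩ := seq_eq_empty_iff.1 hW
    exact ⟨q, .trivial q, .trivial q⟩
  | @letter q q' a h =>
    rcases eq_empty_of_prim_eq_seq hW.symm with rfl | rfl
    · rw [empty_seq] at hW
      exact ⟨q, .trivial q, hW ▸ .letter h⟩
    · rw [seq_empty] at hW
      exact ⟨q', hW ▸ .letter h, .trivial q'⟩
  | comp h₁ h₂ ih₁ ih₂ =>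
    -- The cut of `seq U V` falls within the second or the first half of the run; induction splits
    -- that half.
    obtain ⟨Z, ⟨rfl, rfl⟩ | ⟨rfl, rfl⟩⟩ := levi hW
    · obtain ⟨p, hp, hp'⟩ := ih₂ rfl
      exact ⟨p, .comp h₁ hp, hp'⟩
    · obtain ⟨p, hp, hp'⟩ := ih₁ rfl
      exact ⟨p, hp, .comp hp' h₂⟩
  | @fork q q' n r r' W hr hF hq ih =>
    obtain ⟨X, Y, hXY, hX, hY⟩ := hA.exists_par hr hF hq
    have hrun : A.Run q (parList (List.ofFn W)) q' := .fork r r' W hr hF hq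
    rcases (eq_empty_of_par_eq_seq (hXY.symm.trans hW.symm)).resolve_left (by simp [hX, hY]) with
      rfl | rfl
    · rw [empty_seq] at hW
      exact ⟨q, .trivial q, hW ▸ hrun⟩
    · rw [seq_empty] at hW
      exact ⟨q', hW ▸ hrun, .trivial q'⟩

/-- The runs on a parallel composition of nonempty pomsets consist of a single fork. -/
theorem WellStructured.exists_fork_of_run_par (hA : A.WellStructured) {q q' : Q}
    {X Y : Pomset S} (h : A.Run q (par X Y) q') (hX : X ≠ empty) (hY : Y ≠ empty) :
    ∃ (n : ℕ) (r r' : Fin n → Q) (U : Fin n → Pomset S), (∀ i, A.Run (r i) (U i) (r' i)) ∧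
      (∀ i, r' i ∈ A.F) ∧ q' ∈ A.γ q (List.ofFn r : Multiset Q) ∧
      parList (List.ofFn U) = par X Y := by
  generalize hW : par X Y = W at h
  induction h with
  | trivial q => exact absurd (par_eq_empty_iff.1 hW).1 hX
  | letter h => exact absurd (eq_empty_of_prim_eq_par hW.symm) (by simp [hX, hY])
  | comp h₁ h₂ ih₁ ih₂ =>
    rcases (eq_empty_of_par_eq_seq hW).resolve_left (by simp [hX, hY]) with rfl | rfl
    · obtain rfl := hA.run_empty_iff.1 h₁
      rw [empty_seq] at *
      exact ih₂ hW
    · obtain rfl := hA.run_empty_iff.1 h₂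
      rw [seq_empty] at *
      exact ih₁ hW
  | @fork q q' n r r' W hr hF hq ih => exact ⟨n, r, r', W, hr, hF, hq, rfl⟩

/-- The pomsets in the language of a thread are parallel-prime. -/
theorem WellStructured.parPrime_of_isThread (hA : A.WellStructured) {r r' : Q} {U : Pomset S}
    (hr : A.IsThread r) (h : A.Run r U r') (hF : r' ∈ A.F) : ParPrime U := by
  refine ⟨hA.ne_empty_of_isThread hr h hF, ?_⟩
  rintro X Y rfl
  by_contra! hne
  -- A run on a proper parallel composition is one fork, which from a thread never ends in an
  -- accepting state.
  obtain ⟨n, s, s', W, -, -, hq, -⟩ := hA.exists_fork_of_run_par h hne.1 hne.2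
  obtain ⟨q, φ, hφ, hq'⟩ := hr
  exact Set.disjoint_left.1 (((hA q φ hq').2 r hφ).2 _) hq hF

/-- `A.Accepts r U`: some run on `U` leads from `r` to an accepting state. -/
def Accepts (A : PomsetAutomaton S Q) (U : Pomset S) (r : Q) : Prop := ∃ r' ∈ A.F, A.Run r U r'

theorem mem_language_iff {q : Q} {U : Pomset S} : U ∈ A.language q ↔ A.Accepts U q :=
  ⟨fun h => h.2, fun h => ⟨h.elim fun _ h => h.2.isSP, h⟩⟩

/-- The run is a single fork whose threads read primes. Unique factorisation identifies these with
the members of `l`, so the right side involves only the states that accept each factor. -/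
theorem WellStructured.run_parList_iff (hA : A.WellStructured) {q q' : Q}
    {l : List (Pomset S)} (hl : ∀ U ∈ l, ParPrime U) (h2 : 2 ≤ l.length) :
    A.Run q (parList l) q' ↔
      ∃ m : List Q, List.Forall₂ A.Accepts l m ∧ q' ∈ A.γ q (m : Multiset Q) := by
  constructor
  · intro h
    obtain ⟨X, Y, hXY, hX, hY⟩ := exists_par_of_two_le_length h2 fun U hU => (hl U hU).1
    rw [hXY] at h
    obtain ⟨n, r, r', W, hr, hF, hq, hW⟩ := hA.exists_fork_of_run_par h hX hY
    have hp : l.Perm (List.ofFn W) := perm_of_parList_eq hl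
      (by simpa using fun i => hA.parPrime_of_isThread (isThread_of_mem_γ hq i) (hr i) (hF i))
      (hXY.trans hW.symm)
    have hall : List.Forall₂ A.Accepts (List.ofFn W) (List.ofFn r) := by
      rw [List.forall₂_iff_get]
      refine ⟨by simp, fun i h₁ h₂ => ?_⟩
      simp only [List.get_ofFn]
      exact ⟨_, hF _, hr _⟩
    have hc : Relation.Comp List.Perm (List.Forall₂ A.Accepts) l (List.ofFn r) := ⟨_, hp, hall⟩
    -- The permutation passes from the pomsets to the threads, where the fork multiset absorbs it.
    rw [← List.forall₂_comp_perm_eq_perm_comp_forall₂] at hc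
    obtain ⟨m, hm, hmr⟩ := hc
    exact ⟨m, hm, by rwa [Multiset.coe_eq_coe.2 hmr]⟩
  · rintro ⟨m, hm, hq⟩
    obtain ⟨hlen, hget⟩ := List.forall₂_iff_get.1 hm
    have hrun := fun i : Fin l.length => hget i i.2 (hlen ▸ i.2)
    choose r' hF hr using hrun
    have := Run.fork (A := A) (q := q) (q' := q') (fun i : Fin l.length => m.get (i.cast hlen)) r'
      (fun i => l.get i) hr hF (by
        convert hq using 2
        refine congrArg _ (List.ext_get (by simp [hlen]) fun i h₁ h₂ => by simp))
    rwa [List.ofFn_get] at this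

end PomsetAutomaton

/-! ### The saturation procedure on behaviours -/

namespace PACode

/-- The pairs of numbers below `n` that satisfy `p`, as a list in a fixed order. -/
def tabulate (n : ℕ) (p : ℕ → ℕ → Prop) [∀ i j, Decidable (p i j)] : List (ℕ × ℕ) :=
  ((List.range n).product (List.range n)).filter fun x => p x.1 x.2

theorem mem_tabulate {n : ℕ} {p : ℕ → ℕ → Prop} {_ : ∀ i j, Decidable (p i j)} {i j : ℕ} :
    (i, j) ∈ tabulate n p ↔ (i < n ∧ j < n) ∧ p i j := by
  simp [tabulate]

/-- A relation has exactly one list, so equality of behaviours is equality of lists. The two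
decidability instances are independent, because computed tables are compared with classical ones. -/
theorem tabulate_congr {n : ℕ} {p p' : ℕ → ℕ → Prop} {_ : ∀ i j, Decidable (p i j)}
    {_ : ∀ i j, Decidable (p' i j)} (h : ∀ i < n, ∀ j < n, (p i j ↔ p' i j)) :
    tabulate n p = tabulate n p' := by
  refine List.filter_congr ?_
  rintro ⟨i, j⟩ hx
  rw [List.pair_mem_product, List.mem_range, List.mem_range] at hx
  exact decide_eq_decide.2 (h i hx.1 j hx.2)

/-- Whether a run described by the list `b` of pairs of states leads from `i` to acceptance. -/
def Accepts (c : PACode) (b : List (ℕ × ℕ)) (i : ℕ) : Prop :=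
  ∃ x ∈ b, x.1 = i ∧ x.2 ∈ c.accepting

instance (c : PACode) (b : List (ℕ × ℕ)) (i : ℕ) : Decidable (c.Accepts b i) :=
  inferInstanceAs (Decidable (∃ x ∈ b, x.1 = i ∧ x.2 ∈ c.accepting))

/-- The states from which `b` leads to acceptance. -/
def acceptedStates (c : PACode) (b : List (ℕ × ℕ)) : List ℕ :=
  (List.range c.numStates).filter fun i => c.Accepts b i

/-- The behaviour of a letter. -/
def letterBeh (c : PACode) (a : ℕ) : List (ℕ × ℕ) :=
  tabulate c.numStates fun i j => (i, a, j) ∈ c.seqTrans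

/-- The behaviour of a sequential composition. -/
def seqBeh (c : PACode) (b b' : List (ℕ × ℕ)) : List (ℕ × ℕ) :=
  tabulate c.numStates fun i j => ∃ x ∈ b, x.1 = i ∧ (x.2, j) ∈ b'

/-- The behaviour of a parallel composition of at least two parallel-prime pomsets. -/
def parBeh (c : PACode) (l : List (List (ℕ × ℕ))) : List (ℕ × ℕ) :=
  tabulate c.numStates fun i j => ∃ m ∈ (l.map c.acceptedStates).sections,
    -- The last clause says that `m` is a permutation of the fork list, in a bounded form suited to
    -- primitive recursion.
    ∃ t ∈ c.forkTrans, t.1 = i ∧ t.2.2 = j ∧ ∀ x ∈ m ++ t.2.1, m.count x = t.2.1.count x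

/-- A bound on the number of threads of a fork. -/
def maxArity (c : PACode) : ℕ := (c.forkTrans.flatMap fun t => t.2.1).length

/-- The behaviours in `w` that are marked as those of parallel-prime pomsets. -/
def primeBehs (w : List (Bool × List (ℕ × ℕ))) : List (List (ℕ × ℕ)) :=
  (w.filter fun x => x.1).map fun x => x.2

/-- The behaviours obtained from those in `w` by one operation. -/
def step (c : PACode) (w : List (Bool × List (ℕ × ℕ))) : List (Bool × List (ℕ × ℕ)) :=
  ((List.range c.numLetters).map fun a => (true, c.letterBeh a)) ++
    ((w.flatMap fun x => w.map fun y => (true, c.seqBeh x.2 y.2)) ++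
    -- Lengths 2 to `maxArity + 2`; the largest exceeds every fork and is at least 2, so it stands
    -- for all longer lists.
    (List.range (c.maxArity + 1)).flatMap fun k =>
      ((List.range (k + 2)).map fun _ => primeBehs w).sections.map fun l => (false, c.parBeh l))

/-- The behaviours found after `k` rounds of saturation. -/
def behaviours (c : PACode) (k : ℕ) : List (Bool × List (ℕ × ℕ)) :=
  -- The empty pomset is not seeded: `step` marks every `seqBeh` as prime, which requires nonempty
  -- factors. `Agree` handles it separately.
  k.rec [] fun _ w => w ++ c.step w

/-- No further behaviours are found from those in `w`. -/
def Saturated (c : PACode) (w : List (Bool × List (ℕ × ℕ))) : Prop := ∀ x ∈ c.step w, x ∈ w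

instance (c : PACode) (w : List (Bool × List (ℕ × ℕ))) : Decidable (c.Saturated w) :=
  inferInstanceAs (Decidable (∀ x ∈ c.step w, x ∈ w))

theorem mem_step {c : PACode} {w : List (Bool × List (ℕ × ℕ))} {x : Bool × List (ℕ × ℕ)} :
    x ∈ c.step w ↔ (∃ a < c.numLetters, x = (true, c.letterBeh a)) ∨
      (∃ y ∈ w, ∃ z ∈ w, x = (true, c.seqBeh y.2 z.2)) ∨
      ∃ l : List (List (ℕ × ℕ)), 2 ≤ l.length ∧ l.length ≤ c.maxArity + 2 ∧
        (∀ b ∈ l, (true, b) ∈ w) ∧ x = (false, c.parBeh l) := by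
  have hp : ∀ b, b ∈ primeBehs w ↔ (true, b) ∈ w := fun b => by simp [primeBehs]
  have hs : ∀ k l, l ∈ ((List.range k).map fun _ => primeBehs w).sections ↔
      l.length = k ∧ ∀ b ∈ l, (true, b) ∈ w := by
    intro k l
    rw [List.mem_sections, List.map_const', List.length_range]
    induction l generalizing k with
    | nil => cases k <;> simp [List.replicate_succ]
    | cons b l ih =>
      cases k with
      | zero => simp
      | succ k => simp [List.replicate_succ, ih, hp]; tauto
  simp only [step, List.mem_append, List.mem_map, List.mem_flatMap, List.mem_range, hs]
  refine or_congr (by simp [eq_comm]) (or_congr (by simp [eq_comm]) ⟨?_, ?_⟩)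
  · rintro ⟨k, hk, l, ⟨hl, hw⟩, rfl⟩
    exact ⟨l, by omega, by omega, hw, rfl⟩
  · rintro ⟨l, h2, hl, hw, rfl⟩
    exact ⟨l.length - 2, by omega, l, ⟨by omega, hw⟩, rfl⟩

theorem behaviours_mono (c : PACode) :
    Monotone fun k => {x | x ∈ c.behaviours k} :=
  monotone_nat_of_le_succ fun _ _ hx => List.mem_append_left _ hx

theorem snd_mem_sublists_of_mem_behaviours {c : PACode} {k : ℕ} {x : Bool × List (ℕ × ℕ)}
    (hx : x ∈ c.behaviours k) :
    x.2 ∈ ((List.range c.numStates).product (List.range c.numStates)).sublists := by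
  induction k with
  | zero => cases hx
  | succ k ih =>
    rcases List.mem_append.1 hx with hx | hx
    · exact ih hx
    · rw [List.mem_sublists]
      rcases mem_step.1 hx with ⟨a, -, rfl⟩ | ⟨y, -, z, -, rfl⟩ | ⟨l, -, -, -, rfl⟩ <;>
        exact List.filter_sublist

/-- All behaviours are sublists of one fixed list, so the increasing chain of sets of marked
behaviours lives in a finite set and stabilises. -/
theorem exists_saturated (c : PACode) : ∃ k, c.Saturated (c.behaviours k) := by
  let T : Set (Bool × List (ℕ × ℕ)) :=
    {x | x.2 ∈ ((List.range c.numStates).product (List.range c.numStates)).sublists}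
  have hT : T.Finite := by
    refine ((Set.finite_univ (α := Bool)).prod (List.finite_toSet _)).subset (fun x hx => ⟨trivial, hx⟩)
  have : Finite T := hT
  let f : ℕ →o Set T := ⟨fun k => {x | x.1 ∈ c.behaviours k}, fun i j h x hx =>
    behaviours_mono c h hx⟩
  obtain ⟨k, hk⟩ := WellFoundedGT.monotone_chain_condition f
  refine ⟨k, fun x hx => ?_⟩
  have hx' : x ∈ c.behaviours (k + 1) := List.mem_append_right _ hx
  have : (⟨x, snd_mem_sublists_of_mem_behaviours hx'⟩ : T) ∈ f (k + 1) := hx'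
  rwa [← hk (k + 1) (Nat.le_succ k)] at this

/-- The states `i` and `j` agree on acceptance for the empty pomset and for all behaviours
in `w`. -/
def Agree (c : PACode) (i j : ℕ) (w : List (Bool × List (ℕ × ℕ))) : Prop :=
  (i ∈ c.accepting ↔ j ∈ c.accepting) ∧ ∀ x ∈ w, (c.Accepts x.2 i ↔ c.Accepts x.2 j)

instance (c : PACode) (i j : ℕ) (w : List (Bool × List (ℕ × ℕ))) : Decidable (c.Agree i j w) :=
  inferInstanceAs (Decidable (_ ∧ ∀ x ∈ w, (c.Accepts x.2 i ↔ c.Accepts x.2 j)))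

/-- The decision procedure: saturate, then compare. -/
def decideEquiv (x : PACode × ℕ × ℕ) : Bool :=
  x.1.Agree x.2.1 x.2.2 (x.1.behaviours (Nat.find x.1.exists_saturated))

/-! ### Correctness: listed behaviours are those of nonempty series-parallel pomsets -/

section Correctness

open Pomset PomsetAutomaton

variable {c : PACode} {S : Type u} {Q : Type v} {A : PomsetAutomaton S Q}
  {st : Q ≃ Fin c.numStates} {lt : S ≃ Fin c.numLetters}

/-- The behaviour of a pomset: the pairs of states connected by a run. -/
noncomputable def beh (A : PomsetAutomaton S Q) (st : Q ≃ Fin c.numStates) (U : Pomset S) :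
    List (ℕ × ℕ) :=
  @tabulate c.numStates (fun i j => ∃ q q', (st q : ℕ) = i ∧ (st q' : ℕ) = j ∧ A.Run q U q')
    fun _ _ => Classical.propDecidable _

theorem val_injective (st : Q ≃ Fin c.numStates) : Function.Injective fun q => (st q : ℕ) :=
  Fin.val_injective.comp st.injective

theorem exists_val_eq (st : Q ≃ Fin c.numStates) {i : ℕ} (hi : i < c.numStates) :
    ∃ q, (st q : ℕ) = i := ⟨st.symm ⟨i, hi⟩, by simp⟩

theorem mem_beh {q q' : Q} {U : Pomset S} :
    ((st q : ℕ), (st q' : ℕ)) ∈ beh A st U ↔ A.Run q U q' := by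
  rw [beh, mem_tabulate]
  constructor
  · rintro ⟨-, p, p', h, h', hr⟩
    obtain rfl := val_injective st h
    obtain rfl := val_injective st h'
    exact hr
  · exact fun h => ⟨⟨(st q).2, (st q').2⟩, q, q', rfl, rfl, h⟩

theorem exists_of_mem_beh {x : ℕ × ℕ} {U : Pomset S} (h : x ∈ beh A st U) :
    ∃ q q', x = ((st q : ℕ), (st q' : ℕ)) ∧ A.Run q U q' := by
  obtain ⟨i, j⟩ := x
  obtain ⟨-, q, q', rfl, rfl, hr⟩ := mem_tabulate.1 h
  exact ⟨q, q', rfl, hr⟩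

theorem tabulate_eq_beh {p : ℕ → ℕ → Prop} [∀ i j, Decidable (p i j)] {U : Pomset S}
    (h : ∀ q q', p (st q) (st q') ↔ A.Run q U q') : tabulate c.numStates p = beh A st U := by
  classical
  refine tabulate_congr fun i hi j hj => ?_
  obtain ⟨q, rfl⟩ := exists_val_eq st hi
  obtain ⟨q', rfl⟩ := exists_val_eq st hj
  rw [h, ← mem_beh (st := st), beh, mem_tabulate, and_iff_right ⟨hi, hj⟩]

theorem accepts_beh_iff (hc : c.Encodes A st lt) {q : Q} {U : Pomset S} :
    c.Accepts (beh A st U) (st q) ↔ A.Accepts U q := by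
  constructor
  · rintro ⟨x, hx, h, hF⟩
    obtain ⟨p, p', rfl, hr⟩ := exists_of_mem_beh hx
    obtain rfl := val_injective st h
    exact ⟨p', (hc.accepting_iff p').2 hF, hr⟩
  · rintro ⟨q', hF, hr⟩
    exact ⟨_, mem_beh.2 hr, rfl, (hc.accepting_iff q').1 hF⟩

theorem letterBeh_eq (hA : A.WellStructured) (hc : c.Encodes A st lt) (a : S) :
    c.letterBeh (lt a) = beh A st (prim a) :=
  tabulate_eq_beh fun q q' => by rw [hA.run_prim_iff, hc.seqTrans_iff]

theorem seqBeh_eq (hA : A.WellStructured) (U V : Pomset S) :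
    c.seqBeh (beh A st U) (beh A st V) = beh A st (seq U V) :=
  tabulate_eq_beh fun q q' => by
    rw [hA.run_seq_iff]
    constructor
    · rintro ⟨x, hx, h, hV⟩
      obtain ⟨p, p', rfl, hr⟩ := exists_of_mem_beh hx
      obtain rfl := val_injective st h
      exact ⟨p', hr, mem_beh.1 hV⟩
    · rintro ⟨q'', h₁, h₂⟩
      exact ⟨_, mem_beh.2 h₁, rfl, mem_beh.2 h₂⟩

theorem forall_count_eq_iff {m l : List ℕ} :
    (∀ x ∈ m ++ l, m.count x = l.count x) ↔ m.Perm l := by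
  rw [List.perm_iff_count]
  refine ⟨fun h x => ?_, fun h x _ => h x⟩
  by_cases hx : x ∈ m ++ l
  · exact h x hx
  · rw [List.mem_append, not_or] at hx
    rw [List.count_eq_zero_of_not_mem hx.1, List.count_eq_zero_of_not_mem hx.2]

theorem mem_acceptedStates (hc : c.Encodes A st lt) {q : Q} {U : Pomset S} :
    (st q : ℕ) ∈ c.acceptedStates (beh A st U) ↔ A.Accepts U q := by
  rw [acceptedStates, List.mem_filter, decide_eq_true_iff, accepts_beh_iff hc]
  simp

theorem parBeh_eq (hA : A.WellStructured) (hc : c.Encodes A st lt) {l : List (Pomset S)}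
    (hl : ∀ U ∈ l, ParPrime U) (h2 : 2 ≤ l.length) :
    c.parBeh (l.map (beh A st)) = beh A st (parList l) :=
  tabulate_eq_beh fun q q' => by
    have key : ∀ m : List Q, m.map (fun r => (st r : ℕ)) ∈
        ((l.map (beh A st)).map c.acceptedStates).sections ↔ List.Forall₂ A.Accepts l m := by
      intro m
      rw [List.mem_sections, List.map_map, List.forall₂_map_left_iff, List.forall₂_map_right_iff]
      simp only [Function.comp, mem_acceptedStates hc]
      exact ⟨fun h => h.flip, fun h => h.flip⟩
    rw [hA.run_parList_iff hl h2]
    simp only [forall_count_eq_iff]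
    constructor
    · rintro ⟨m, hm, ⟨i, l', j⟩, ht, rfl, rfl, hp⟩
      -- Entries of a section are accepted states, hence in range, hence numbers of actual states.
      have hr : m ∈ Set.range (List.map fun r => (st r : ℕ)) := by
        rw [Set.range_list_map]
        intro i hi
        have hf := List.mem_sections.1 hm
        rw [List.forall₂_map_right_iff] at hf
        obtain ⟨k, hk, rfl⟩ := List.getElem_of_mem hi
        have hs := hf.get hk (hf.length_eq ▸ hk)
        exact exists_val_eq st (List.mem_range.1 (List.mem_filter.1 hs).1)
      obtain ⟨m, rfl⟩ := hr
      exact ⟨m, (key m).1 hm, (hc.forkTrans_iff _ _ _).2 ⟨l', by simpa using hp.symm, ht⟩⟩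
    · rintro ⟨m, hm, hq⟩
      obtain ⟨l', hl', ht⟩ := (hc.forkTrans_iff _ _ _).1 hq
      exact ⟨_, (key m).2 hm, _, ht, rfl, rfl, Multiset.coe_eq_coe.1 hl'.symm⟩

/-- A matching fork has one thread per factor, while `maxArity` is the total length of all fork
lists. -/
theorem parBeh_eq_nil {l : List (List (ℕ × ℕ))} (h : c.maxArity < l.length) :
    c.parBeh l = [] := by
  rw [parBeh, tabulate, List.filter_eq_nil_iff]
  rintro ⟨i, j⟩ -
  simp only [forall_count_eq_iff, decide_eq_true_eq]
  rintro ⟨m, hm, t, ht, -, -, hp⟩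
  have h1 : m.length = l.length := by simpa using List.mem_sections_length hm
  have h2 : t.2.1.length ≤ c.maxArity := by
    rw [maxArity, List.flatMap_def]
    exact (List.sublist_flatten_of_mem (List.mem_map_of_mem
      (f := fun t : ℕ × List ℕ × ℕ => t.2.1) ht)).length_le
  have h3 := hp.length_eq
  omega

/-- Soundness of saturation. Nonemptiness is carried along so that sequential compositions come out
prime. -/
theorem exists_pomset_of_mem_behaviours (hA : A.WellStructured) (hc : c.Encodes A st lt) {k : ℕ}
    {x : Bool × List (ℕ × ℕ)} (hx : x ∈ c.behaviours k) :
    ∃ U : Pomset S, U ≠ empty ∧ (x.1 = true → ParPrime U) ∧ x.2 = beh A st U := by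
  induction k generalizing x with
  | zero => cases hx
  | succ k ih =>
    rcases List.mem_append.1 hx with h | h
    · exact ih h
    clear hx
    rcases mem_step.1 h with ⟨a, ha, rfl⟩ | ⟨y, hy, z, hz, rfl⟩ | ⟨l, h2, -, hl, rfl⟩
    · have := letterBeh_eq hA hc (lt.symm ⟨a, ha⟩)
      rw [Equiv.apply_symm_apply] at this
      exact ⟨_, prim_ne_empty _, fun _ => parPrime_prim _, this⟩
    · obtain ⟨U, hU, -, hy⟩ := ih hy
      obtain ⟨V, hV, -, hz⟩ := ih hz
      exact ⟨seq U V, (parPrime_seq hU hV).1, fun _ => parPrime_seq hU hV, by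
        rw [hy, hz, seqBeh_eq hA]⟩
    · clear h
      have : ∃ m : List (Pomset S), (∀ U ∈ m, ParPrime U) ∧ l = m.map (beh A st) := by
        clear h2
        induction l with
        | nil => exact ⟨[], by simp, rfl⟩
        | cons b l ihl =>
          obtain ⟨m, hm, rfl⟩ := ihl fun b hb => hl b (List.mem_cons_of_mem _ hb)
          obtain ⟨U, -, hU, hb⟩ := ih (hl b List.mem_cons_self)
          exact ⟨U :: m, by simpa using ⟨hU rfl, hm⟩, by rw [List.map_cons, ← hb]⟩
      obtain ⟨m, hm, rfl⟩ := this
      rw [List.length_map] at h2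
      obtain ⟨X, Y, hXY, hX, -⟩ := exists_par_of_two_le_length h2 fun U hU => (hm U hU).1
      exact ⟨parList m, fun h => hX (par_eq_empty_iff.1 (hXY ▸ h)).1, by simp,
        parBeh_eq hA hc hm h2⟩

theorem mem_of_parList (hA : A.WellStructured) (hc : c.Encodes A st lt)
    {w : List (Bool × List (ℕ × ℕ))} (hw : c.Saturated w) {l : List (Pomset S)}
    (hl : ∀ U ∈ l, ParPrime U ∧ (true, beh A st U) ∈ w) :
    parList l = empty ∨ ∃ f, (f, beh A st (parList l)) ∈ w := by
  match l with
  | [] => exact Or.inl rfl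
  | [U] => exact Or.inr ⟨true, by rw [parList_singleton]; exact (hl U (by simp)).2⟩
  | U :: V :: l =>
    right
    refine ⟨false, hw _ (mem_step.2 (Or.inr (Or.inr ?_)))⟩
    rw [← parBeh_eq hA hc (fun U hU => (hl U hU).1) (by simp)]
    have hl' : ∀ b ∈ (U :: V :: l).map (beh A st), (true, b) ∈ w := by
      intro b hb
      obtain ⟨W, hW, rfl⟩ := List.mem_map.1 hb
      exact (hl W hW).2
    generalize hb : (U :: V :: l).map (beh A st) = bs at hl'
    have h2 : 2 ≤ bs.length := by simp [← hb]
    rcases le_or_gt bs.length (c.maxArity + 2) with h | h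
    · exact ⟨bs, h2, h, hl', rfl⟩
    -- Both the long list and this prefix exceed `maxArity`, so both give the empty behaviour, and
    -- `step` does try the prefix.
    · have ht : (bs.take (c.maxArity + 2)).length = c.maxArity + 2 := by
        rw [List.length_take, min_eq_left h.le]
      refine ⟨bs.take (c.maxArity + 2), by omega, by omega,
        fun b hb => hl' b (List.mem_of_mem_take hb), ?_⟩
      rw [parBeh_eq_nil (by omega), parBeh_eq_nil (by omega)]

/-- Completeness of saturation. The induction tracks prime factors: under `∥` their lists are
concatenated, and under `·` of nonempty pomsets they collapse to one new prime. -/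
theorem exists_eq_parList (hA : A.WellStructured) (hc : c.Encodes A st lt)
    {w : List (Bool × List (ℕ × ℕ))} (hw : c.Saturated w) {U : Pomset S} (hU : U.IsSP) :
    ∃ l : List (Pomset S), U = parList l ∧
      ∀ V ∈ l, ParPrime V ∧ (true, beh A st V) ∈ w := by
  induction hU with
  | empty => exact ⟨[], rfl, by simp⟩
  | prim a =>
    refine ⟨[prim a], (parList_singleton _).symm, ?_⟩
    rintro V hV
    obtain rfl := List.mem_singleton.1 hV
    exact ⟨parPrime_prim a, hw _ (mem_step.2 (Or.inl ⟨lt a, (lt a).2, by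
      rw [letterBeh_eq hA hc]⟩))⟩
  | @seq U V hU hV ihU ihV =>
    by_cases hU0 : U = empty
    · rwa [hU0, empty_seq]
    by_cases hV0 : V = empty
    · rwa [hV0, seq_empty]
    obtain ⟨l, rfl, hl⟩ := ihU
    obtain ⟨m, rfl, hm⟩ := ihV
    obtain ⟨f, hf⟩ := (mem_of_parList hA hc hw hl).resolve_left hU0
    obtain ⟨g, hg⟩ := (mem_of_parList hA hc hw hm).resolve_left hV0
    refine ⟨[_], (parList_singleton _).symm, ?_⟩
    rintro W hW
    obtain rfl := List.mem_singleton.1 hW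
    exact ⟨parPrime_seq hU0 hV0, hw _ (mem_step.2 (Or.inr (Or.inl ⟨_, hf, _, hg, by
      rw [seqBeh_eq hA]⟩)))⟩
  | @par U V hU hV ihU ihV =>
    obtain ⟨l, rfl, hl⟩ := ihU
    obtain ⟨m, rfl, hm⟩ := ihV
    refine ⟨l ++ m, (parList_append l m).symm, fun W hW => ?_⟩
    exact (List.mem_append.1 hW).elim (hl W) (hm W)

theorem decideEquiv_eq_true_iff (hA : A.WellStructured) (hc : c.Encodes A st lt) (q₁ q₂ : Q) :
    decideEquiv (c, (st q₁ : ℕ), (st q₂ : ℕ)) = true ↔ A.language q₁ = A.language q₂ := by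
  have hempty : ∀ q, A.Accepts empty q ↔ (st q : ℕ) ∈ c.accepting := fun q => by
    simp only [PomsetAutomaton.Accepts, hA.run_empty_iff, exists_eq_right', hc.accepting_iff]
  have hlang : ∀ U : Pomset S, (A.Accepts U q₁ ↔ A.Accepts U q₂) ↔
      (U ∈ A.language q₁ ↔ U ∈ A.language q₂) := fun U => by
    rw [mem_language_iff, mem_language_iff]
  rw [decideEquiv, decide_eq_true_iff, Set.ext_iff]
  simp only [← hlang]
  constructor
  · rintro ⟨h0, h⟩ U
    by_cases hSP : U.IsSP
    · obtain ⟨l, rfl, hl⟩ :=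
        exists_eq_parList hA hc (Nat.find_spec c.exists_saturated) hSP
      rcases mem_of_parList hA hc (Nat.find_spec c.exists_saturated) hl with hU | ⟨f, hf⟩
      · rw [hU, hempty, hempty]
        exact h0
      · simpa only [accepts_beh_iff hc] using h _ hf
    -- Pomsets that are not series-parallel have no runs at all.
    · exact iff_of_false (fun ⟨_, _, h⟩ => hSP h.isSP) (fun ⟨_, _, h⟩ => hSP h.isSP)
  · intro h
    refine ⟨by rw [← hempty, ← hempty]; exact h _, fun x hx => ?_⟩
    obtain ⟨U, -, -, hU⟩ := exists_pomset_of_mem_behaviours hA hc hx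
    rw [hU, accepts_beh_iff hc, accepts_beh_iff hc]
    exact h U

end Correctness

end PACode

/-! ### Primitive recursion for list operations -/

section Primrec

variable {α β γ : Type*} [Primcodable α] [Primcodable β] [Primcodable γ]

theorem PrimrecPred.exists_mem {f : α → List β} {p : α → β → Prop} (hf : Primrec f)
    (hp : PrimrecRel p) : PrimrecPred fun a => ∃ b ∈ f a, p a b :=
  have hp' : PrimrecRel fun b a => p a b := PrimrecRel.comp hp .snd .fst
  hp'.exists_mem_list.comp hf .id

theorem PrimrecPred.forall_mem {f : α → List β} {p : α → β → Prop} (hf : Primrec f)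
    (hp : PrimrecRel p) : PrimrecPred fun a => ∀ b ∈ f a, p a b :=
  have hp' : PrimrecRel fun b a => p a b := PrimrecRel.comp hp .snd .fst
  hp'.forall_mem_list.comp hf .id

theorem PrimrecPred.mem {f : α → β} {l : α → List β} (hf : Primrec f) (hl : Primrec l) :
    PrimrecPred fun a => f a ∈ l a :=
  (PrimrecPred.exists_mem (p := fun a b => b = f a) hl
    (Primrec.eq.comp .snd (hf.comp .fst))).of_eq fun a => by simp

theorem PrimrecPred.iff {p q : α → Prop} (hp : PrimrecPred p) (hq : PrimrecPred q) :
    PrimrecPred fun a => (p a ↔ q a) :=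
  ((hp.and hq).or (hp.not.and hq.not)).of_eq fun _ => iff_iff_and_or_not_and_not.symm

theorem Primrec.filter {f : α → List β} {p : α → β → Prop} [∀ a, DecidablePred (p a)]
    (hf : Primrec f) (hp : PrimrecRel p) : Primrec fun a => (f a).filter fun b => p a b := by
  classical
  have hp' : PrimrecRel fun b a => p a b := PrimrecRel.comp hp .snd .fst
  exact (hp'.listFilter.comp hf .id).of_eq fun a => List.filter_congr fun b _ => by simp

theorem Primrec.count [DecidableEq β] {f : α → β} {l : α → List β} (hf : Primrec f)
    (hl : Primrec l) : Primrec fun a => (l a).count (f a) :=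
  (Primrec.list_length.comp (Primrec.filter (p := fun a b => b = f a) hl
    (Primrec.eq.comp .snd (hf.comp .fst)))).of_eq fun a => by
      rw [List.count, List.countP_eq_length_filter]
      congr 2

theorem Primrec.sections {f : α → List (List β)} (hf : Primrec f) :
    Primrec fun a => (f a).sections := by
  refine (Primrec.list_foldr hf (Primrec.const [[]])
    (h := fun _ x => x.2.flatMap fun s => x.1.map fun b => b :: s) ?_).of_eq fun a => ?_
  · exact Primrec.list_flatMap (Primrec.snd.comp .snd)
      (Primrec.list_map (Primrec.fst.comp (Primrec.snd.comp .fst))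
        (Primrec.list_cons.comp .snd (Primrec.snd.comp .fst)))
  · induction f a with
    | nil => rfl
    | cons l L ih => rw [List.foldr_cons, ih]; rfl

end Primrec

/-! ### Computability of the decision procedure -/

namespace PACode

variable {α : Type*} [Primcodable α]

theorem primrec_numStates : Primrec numStates := .fst
theorem primrec_numLetters : Primrec numLetters := Primrec.fst.comp .snd
theorem primrec_accepting : Primrec accepting := Primrec.fst.comp (Primrec.snd.comp .snd)
theorem primrec_seqTrans : Primrec seqTrans :=
  Primrec.fst.comp (Primrec.snd.comp (Primrec.snd.comp .snd))
theorem primrec_forkTrans : Primrec forkTrans :=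
  Primrec.snd.comp (Primrec.snd.comp (Primrec.snd.comp .snd))

theorem primrec_tabulate {n : α → ℕ} {p : α → ℕ → ℕ → Prop} [∀ a i j, Decidable (p a i j)]
    (hn : Primrec n) (hp : PrimrecRel fun a (x : ℕ × ℕ) => p a x.1 x.2) :
    Primrec fun a => tabulate (n a) (p a) :=
  have hr := Primrec.list_range.comp hn
  Primrec.filter (p := fun a (x : ℕ × ℕ) => p a x.1 x.2)
    (Primrec.list_flatMap hr (Primrec.list_map (hr.comp .fst)
      (Primrec.pair (Primrec.snd.comp .fst) .snd))) hp

theorem primrecPred_accepts {c : α → PACode} {b : α → List (ℕ × ℕ)} {i : α → ℕ}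
    (hc : Primrec c) (hb : Primrec b) (hi : Primrec i) :
    PrimrecPred fun a => (c a).Accepts (b a) (i a) :=
  PrimrecPred.exists_mem hb <|
    (Primrec.eq.comp (Primrec.fst.comp .snd) (hi.comp .fst)).and <|
      PrimrecPred.mem (Primrec.snd.comp .snd) (primrec_accepting.comp (hc.comp .fst))

theorem primrec_acceptedStates : Primrec₂ acceptedStates :=
  Primrec.filter (p := fun (x : PACode × List (ℕ × ℕ)) i => x.1.Accepts x.2 i)
    (Primrec.list_range.comp (primrec_numStates.comp .fst))
    (primrecPred_accepts (Primrec.fst.comp .fst) (Primrec.snd.comp .fst) .snd)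

theorem primrec_letterBeh : Primrec₂ letterBeh :=
  primrec_tabulate (primrec_numStates.comp .fst)
    (PrimrecPred.mem
      (Primrec.pair (Primrec.fst.comp .snd)
        (Primrec.pair (Primrec.snd.comp .fst) (Primrec.snd.comp .snd)))
      (primrec_seqTrans.comp (Primrec.fst.comp .fst)))

theorem primrec_seqBeh :
    Primrec fun x : PACode × List (ℕ × ℕ) × List (ℕ × ℕ) => x.1.seqBeh x.2.1 x.2.2 :=
  primrec_tabulate (primrec_numStates.comp .fst) <|
    PrimrecPred.exists_mem (Primrec.fst.comp (Primrec.snd.comp .fst)) <|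
      (Primrec.eq.comp (Primrec.fst.comp .snd) (Primrec.fst.comp (Primrec.snd.comp .fst))).and <|
        PrimrecPred.mem
          (Primrec.pair (Primrec.snd.comp .snd) (Primrec.snd.comp (Primrec.snd.comp .fst)))
          (Primrec.snd.comp (Primrec.snd.comp (Primrec.fst.comp .fst)))

theorem primrec_parBeh : Primrec₂ parBeh :=
  primrec_tabulate (primrec_numStates.comp .fst) <|
    PrimrecPred.exists_mem
      (Primrec.sections (Primrec.list_map (Primrec.snd.comp .fst)
        (primrec_acceptedStates.comp (Primrec.fst.comp (Primrec.fst.comp .fst)) .snd))) <|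
      PrimrecPred.exists_mem
        (primrec_forkTrans.comp (Primrec.fst.comp (Primrec.fst.comp .fst))) <|
        (Primrec.eq.comp (Primrec.fst.comp .snd)
          (Primrec.fst.comp (Primrec.snd.comp (Primrec.fst.comp .fst)))).and <|
        (Primrec.eq.comp (Primrec.snd.comp (Primrec.snd.comp .snd))
          (Primrec.snd.comp (Primrec.snd.comp (Primrec.fst.comp .fst)))).and <|
        have hm := Primrec.snd.comp .fst
        have ht := Primrec.fst.comp (Primrec.snd.comp .snd)
        PrimrecPred.forall_mem (Primrec.list_append.comp hm ht) <|
          Primrec.eq.comp (Primrec.count .snd (hm.comp .fst)) (Primrec.count .snd (ht.comp .fst))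

theorem primrec_maxArity : Primrec maxArity :=
  Primrec.list_length.comp
    (Primrec.list_flatMap primrec_forkTrans (Primrec.fst.comp (Primrec.snd.comp .snd)))

theorem primrec_primeBehs : Primrec primeBehs :=
  Primrec.list_map
    ((Primrec.filter (p := fun (_ : List (Bool × List (ℕ × ℕ))) x => x.1 = true) .id
      (Primrec.eq.comp (Primrec.fst.comp .snd) (.const true))).of_eq fun w => by simp)
    (Primrec.snd.comp .snd)

theorem primrec_seqBehs : Primrec fun x : PACode × List (Bool × List (ℕ × ℕ)) =>
    x.2.flatMap fun y => x.2.map fun z => (true, x.1.seqBeh y.2 z.2) := by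
  refine Primrec.list_flatMap .snd (Primrec.list_map (Primrec.snd.comp .fst) ?_)
  have h : Primrec fun y : ((PACode × List (Bool × List (ℕ × ℕ))) × Bool × List (ℕ × ℕ)) ×
      Bool × List (ℕ × ℕ) => (y.1.1.1, y.1.2.2, y.2.2) :=
    Primrec.pair (Primrec.fst.comp (Primrec.fst.comp .fst))
      (Primrec.pair (Primrec.snd.comp (Primrec.snd.comp .fst)) (Primrec.snd.comp .snd))
  exact Primrec.pair (.const true) ((primrec_seqBeh.comp h).of_eq fun _ => rfl)

theorem primrec_parBehs : Primrec fun x : PACode × List (Bool × List (ℕ × ℕ)) =>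
    (List.range (x.1.maxArity + 1)).flatMap fun k =>
      ((List.range (k + 2)).map fun _ => primeBehs x.2).sections.map fun l =>
        (false, x.1.parBeh l) := by
  refine Primrec.list_flatMap
    (Primrec.list_range.comp (Primrec.succ.comp (primrec_maxArity.comp .fst)))
    (Primrec.list_map ?_ ?_)
  · exact Primrec.sections (Primrec.list_map
      (Primrec.list_range.comp (Primrec.succ.comp (Primrec.succ.comp .snd)))
      (primrec_primeBehs.comp (Primrec.snd.comp (Primrec.fst.comp .fst))))
  · exact Primrec.pair (.const false)
      (primrec_parBeh.comp (Primrec.fst.comp (Primrec.fst.comp .fst)) .snd)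

theorem primrec_step : Primrec₂ step :=
  Primrec.list_append.comp
    (Primrec.list_map (Primrec.list_range.comp (primrec_numLetters.comp .fst))
      (Primrec.pair (.const true) (primrec_letterBeh.comp (Primrec.fst.comp .fst) .snd)))
    (Primrec.list_append.comp primrec_seqBehs primrec_parBehs)

theorem primrec_behaviours : Primrec₂ behaviours := by
  have h : Primrec₂ fun (c : PACode) (x : ℕ × List (Bool × List (ℕ × ℕ))) => x.2 ++ c.step x.2 :=
    Primrec.list_append.comp (Primrec.snd.comp .snd)
      (primrec_step.comp .fst (Primrec.snd.comp .snd))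
  have hr := Primrec.nat_rec (f := fun _ : PACode => []) (.const []) h
  exact Primrec.of_eq hr fun _ => rfl

theorem primrecRel_saturated : PrimrecRel Saturated :=
  PrimrecPred.forall_mem (primrec_step.comp .fst .snd)
    (PrimrecPred.mem .snd (Primrec.snd.comp .fst))

theorem primrecPred_agree : PrimrecPred
    fun x : (PACode × ℕ × ℕ) × List (Bool × List (ℕ × ℕ)) => x.1.1.Agree x.1.2.1 x.1.2.2 x.2 :=
  have hc : Primrec fun x : (PACode × ℕ × ℕ) × List (Bool × List (ℕ × ℕ)) => x.1.1 :=
    Primrec.fst.comp .fst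
  have hi : Primrec fun x : (PACode × ℕ × ℕ) × List (Bool × List (ℕ × ℕ)) => x.1.2.1 :=
    Primrec.fst.comp (Primrec.snd.comp .fst)
  have hj : Primrec fun x : (PACode × ℕ × ℕ) × List (Bool × List (ℕ × ℕ)) => x.1.2.2 :=
    Primrec.snd.comp (Primrec.snd.comp .fst)
  (PrimrecPred.iff (.mem hi (primrec_accepting.comp hc))
    (.mem hj (primrec_accepting.comp hc))).and <|
    PrimrecPred.forall_mem .snd <| PrimrecPred.iff
      (primrecPred_accepts (hc.comp .fst) (Primrec.snd.comp .snd) (hi.comp .fst))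
      (primrecPred_accepts (hc.comp .fst) (Primrec.snd.comp .snd) (hj.comp .fst))

/-- Unbounded search for the first saturated round; `exists_saturated` makes it total, so no
explicit bound on the number of rounds is needed. -/
theorem computable_find_saturated :
    Computable fun c : PACode => Nat.find c.exists_saturated := by
  have hp : Primrec₂ fun (c : PACode) k => decide (c.Saturated (c.behaviours k)) :=
    PrimrecPred.decide (primrecRel_saturated.comp .fst primrec_behaviours)
  refine (Partrec.rfind (p := fun (c : PACode) k => Part.some (decide (c.Saturated (c.behaviours k))))
    hp.to_comp.partrec₂).of_eq fun c => ?_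
  refine Part.eq_some_iff.2 (Nat.mem_rfind.2 ⟨?_, fun {m} hm => ?_⟩)
  · simpa using Nat.find_spec c.exists_saturated
  · simpa using Nat.find_min c.exists_saturated hm

theorem computable_decideEquiv : Computable decideEquiv := by
  have h : Computable fun x : PACode × ℕ × ℕ =>
      x.1.behaviours (Nat.find x.1.exists_saturated) :=
    primrec_behaviours.to_comp.comp .fst (computable_find_saturated.comp .fst)
  have hd := (PrimrecPred.decide primrecPred_agree).to_comp.comp (Computable.id.pair h)
  exact hd.of_eq fun _ => rfl

end PACode

theorem mainTheorem3 :
    ∃ dec : PACode × ℕ × ℕ → Bool, Computable dec ∧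
      ∀ (S : Type u) (Q : Type v) [Finite S] [Finite Q] (A : PomsetAutomaton S Q),
        A.ForkAcyclic → A.WellStructured →
        ∀ (c : PACode) (st : Q ≃ Fin c.numStates) (lt : S ≃ Fin c.numLetters),
          c.Encodes A st lt →
          ∀ q₁ q₂ : Q,
            dec (c, (st q₁ : ℕ), (st q₂ : ℕ)) = true ↔ A.language q₁ = A.language q₂ :=
  ⟨PACode.decideEquiv, PACode.computable_decideEquiv, fun _ _ _ _ _ _ hA _ _ _ hc q₁ q₂ =>
    PACode.decideEquiv_eq_true_iff hA hc q₁ q₂⟩
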